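/- Let $m,n,k$ be positive integers with $k>m/2$, and let $\boldsymbol p_1,\dots,\boldsymbol p_n\in\mathbb R^m$ be pairwise distinct modulo $\mathbb Z^m$ (that is, $n$ distinct points of the torus $\mathbb T^m=\mathbb R^m/\mathbb Z^m$). For $\lambda>0$ put $$g_\lambda(\boldsymbol x)=\sum_{\boldsymbol l\in\mathbb Z^m}\frac{1}{1+\lambda\|\boldsymbol l\|_{2k}^{2k}}\cos(2\pi\,\boldsymbol l\cdot\boldsymbol x),\qquad \|\boldsymbol l\|_{2k}^{2k}=\sum_{i=1}^m|l_i|^{2k},$$ and let $G_\lambda=[g_\lambda(\boldsymbol p_i-\boldsymbol p_j)]_{1\le i,j\le n}$, a real symmetric matrix with eigenvalues $\rho_1(G_\lambda)\ge\rho_2(G_\lambda)\ge\dots\ge\rho_n(G_\lambda)$, counted with multiplicity. Then: 1. $G_\lambda$ is positive definite for every $\lambda>0$ (in particular for every $\lambda>1$). 2. Each eigenvalue is analytic in $1/\lambda$ at $\lambda=\infty$: for every $l$ there are real coefficients $a_{l0},a_{l1},a_{l2},\dots$, independent of $\lambda$, such that $$\rho_l(G_\lambda)=a_{l0}+\frac{a_{l1}}{\lambda}+\frac{a_{l2}}{\lambda^2}+\cdots$$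 (a convergent series) for all sufficiently large $\lambda$. 3. For any such expansion, $a_{10}=n$, $a_{l0}=0$ for $l=2,\dots,n$, and the first-order coefficients satisfy $a_{l1}>0$ for $l=2,\dots,n$. -/

import Mathlib

/-- The `2k`-th power of the `ℓ^{2k}` norm of an integer vector: `‖l‖_{2k}^{2k} = ∑ i, |l i| ^ (2k)`. -/
def powNorm {m : ℕ} (k : ℕ) (l : Fin m → ℤ) : ℝ :=
  ∑ i, |(l i : ℝ)| ^ (2 * k)

/-- The kernel `g_lam(x) = ∑_{l ∈ ℤ^m} cos (2π l·x) / (1 + lam ‖l‖_{2k}^{2k})`.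
The series converges absolutely for `lam > 0` and `k > m / 2`. -/
noncomputable def kernelG {m : ℕ} (k : ℕ) (lam : ℝ) (x : Fin m → ℝ) : ℝ :=
  ∑' l : Fin m → ℤ,
    1 / (1 + lam * powNorm k l) * Real.cos (2 * Real.pi * ∑ i, (l i : ℝ) * x i)

/-- The matrix `G_lam = [g_lam(p_i - p_j)]`. -/
noncomputable def matG {m n : ℕ} (k : ℕ) (p : Fin n → Fin m → ℝ) (lam : ℝ) :
    Matrix (Fin n) (Fin n) ℝ :=
  Matrix.of fun i j => kernelG k lam (p i - p j)

theorem kernelG_neg {m : ℕ} (k : ℕ) (lam : ℝ) (x : Fin m → ℝ) :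
    kernelG k lam (-x) = kernelG k lam x := by
  simp [kernelG]

theorem matG_isHermitian {m n : ℕ} (k : ℕ) (p : Fin n → Fin m → ℝ) (lam : ℝ) :
    (matG k p lam).IsHermitian := by
  ext i j
  simp only [Matrix.conjTranspose_apply, matG, Matrix.of_apply, star_trivial]
  rw [← kernelG_neg, neg_sub]

/-- The eigenvalues of `G_lam`, listed with multiplicity in descending order;
the index `l : Fin n` is zero-based, so `l = 0` is the largest eigenvalue. -/
noncomputable def rho {m n : ℕ} (k : ℕ) (p : Fin n → Fin m → ℝ) (l : Fin n) (lam : ℝ) : ℝ :=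
  (matG_isHermitian k p lam).eigenvalues₀ (Fin.cast (Fintype.card_fin n).symm l)

/-- `f` is, for all sufficiently large `lam`, the sum of the convergent power series
`a 0 + a 1 / lam + a 2 / lam ^ 2 + ⋯` in `1 / lam`. -/
def HasExpansionAtInfinity (f : ℝ → ℝ) (a : ℕ → ℝ) : Prop :=
  ∀ᶠ lam : ℝ in Filter.atTop, HasSum (fun r : ℕ => a r / lam ^ r) (f lam)

/-- The vectors `p i` represent pairwise distinct points of the torus `ℝ^m / ℤ^m`. -/
def DistinctOnTorus {m n : ℕ} (p : Fin n → Fin m → ℝ) : Prop :=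
  ∀ i j, i ≠ j → ¬ ∃ z : Fin m → ℤ, ∀ t, p i t - p j t = (z t : ℝ)

/-! Write `N(l)` for `powNorm k l`. The form `x ⬝ᵥ G_lam x` is the sum over `l ∈ ℤ^m` of `|μ̂(l)|² /
(1 + lam N(l))`, where `μ = ∑ x_i δ(p_i)` (`hasSum_dotProduct_matG`). All weights are positive, and
distinct torus points give linearly independent characters of `ℤ^m`, so some `μ̂(l)` is nonzero when
`x ≠ 0`: this is positive definiteness.

For the coefficients, the all-ones vector forces the top eigenvalue to be at least `n`, while the
trace tends to `n`; since all eigenvalues are positive, the others tend to `0` (`tendsto_rho`). For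
`lam ≥ 1`, `1 + lam N ≤ lam (1 + N)` gives `lam G_lam ≥ G_1` as forms, so `lam ρ_l` stays above the
least eigenvalue of `G_1` (`exists_pos_le_mul_rho`). When `a_{l0} = 0`, `lam ρ_l` tends to `a_{l1}`,
which is therefore positive.

For analyticity, the entries extend analytically in `t = 1 / lam` through `t = 0`
(`analyticAt_kernelInv`). Rellich's theorem, applied to the characteristic polynomial
(`CoeffAnalytic.hasAnalyticRoots`), yields analytic root branches. It goes by induction on the
degree: center the roots, divide them by the right power of `t` so that they do not all collide at
`0`, and split by an analytic Hensel lemma. Finitely many analytic branches have a fixed order to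
the right of `0`, so the ordered eigenvalues are branches. -/

open Polynomial Filter Topology

/-! ### Polynomial families with analytic coefficients -/

/-- A family of real polynomials whose coefficients are analytic at `0`. -/
def CoeffAnalytic (P : ℝ → ℝ[X]) : Prop :=
  ∀ i, AnalyticAt ℝ (fun t => (P t).coeff i) 0

namespace CoeffAnalytic

theorem congr {P Q : ℝ → ℝ[X]} (hP : CoeffAnalytic P) (h : ∀ᶠ t in 𝓝 0, P t = Q t) :
    CoeffAnalytic Q := fun i =>
  (hP i).congr (h.mono fun _ ht => congrArg (fun p => p.coeff i) ht)

theorem const (p : ℝ[X]) : CoeffAnalytic fun _ => p := fun _ => analyticAt_const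

theorem of_C {f : ℝ → ℝ} (hf : AnalyticAt ℝ f 0) : CoeffAnalytic fun t => C (f t) := by
  intro i
  by_cases hi : i = 0
  · simpa [hi] using hf
  · simpa [coeff_C, hi] using analyticAt_const

theorem add {P Q : ℝ → ℝ[X]} (hP : CoeffAnalytic P) (hQ : CoeffAnalytic Q) :
    CoeffAnalytic fun t => P t + Q t := fun i => by
  simpa using (hP i).fun_add (hQ i)

theorem mul {P Q : ℝ → ℝ[X]} (hP : CoeffAnalytic P) (hQ : CoeffAnalytic Q) :
    CoeffAnalytic fun t => P t * Q t := fun i => by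
  simp only [coeff_mul]
  exact Finset.analyticAt_fun_sum _ fun j _ => (hP j.1).fun_mul (hQ j.2)

theorem pow {P : ℝ → ℝ[X]} (hP : CoeffAnalytic P) (n : ℕ) :
    CoeffAnalytic fun t => P t ^ n := by
  induction n with
  | zero => simpa using const 1
  | succ n ih => simpa only [pow_succ] using ih.mul hP

theorem sum {ι : Type*} (s : Finset ι) {P : ι → ℝ → ℝ[X]} (hP : ∀ i ∈ s, CoeffAnalytic (P i)) :
    CoeffAnalytic fun t => ∑ i ∈ s, P i t := fun j => by
  simp only [finsetSum_coeff]
  exact Finset.analyticAt_fun_sum _ fun i hi => hP i hi j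

theorem prod {ι : Type*} (s : Finset ι) {P : ι → ℝ → ℝ[X]} (hP : ∀ i ∈ s, CoeffAnalytic (P i)) :
    CoeffAnalytic fun t => ∏ i ∈ s, P i t := by
  classical
  induction s using Finset.induction_on with
  | empty => simpa using const 1
  | insert a s ha ih =>
    simp only [Finset.prod_insert ha]
    exact (hP a (Finset.mem_insert_self a s)).mul
      (ih fun i hi => hP i (Finset.mem_insert_of_mem hi))

theorem comp_X_add_C {P : ℝ → ℝ[X]} (hP : CoeffAnalytic P) {n : ℕ}
    (hn : ∀ᶠ t in 𝓝 0, (P t).natDegree = n) {s : ℝ → ℝ} (hs : AnalyticAt ℝ s 0) :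
    CoeffAnalytic fun t => (P t).comp (X + C (s t)) := by
  have h : CoeffAnalytic fun t => ∑ i ∈ Finset.range (n + 1),
      C ((P t).coeff i) * (X + C (s t)) ^ i :=
    sum _ fun i _ => (of_C (hP i)).mul (((const X).add (of_C hs)).pow i)
  refine h.congr (hn.mono fun t ht => ?_)
  rw [comp, eval₂_eq_sum_range, ht]

end CoeffAnalytic

/-! ### Lifting coprime factorizations -/

/-- The polynomial of degree less than `a` with the given coefficients. -/
noncomputable def lowPoly {a : ℕ} (u : Fin a → ℝ) : ℝ[X] := ∑ i, C (u i) * X ^ (i : ℕ)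

theorem lowPoly_coeff {a : ℕ} (u : Fin a → ℝ) (j : ℕ) :
    (lowPoly u).coeff j = if h : j < a then u ⟨j, h⟩ else 0 := by
  simp only [lowPoly, finsetSum_coeff, coeff_C_mul_X_pow]
  split_ifs with h
  · rw [Finset.sum_eq_single ⟨j, h⟩]
    · simp
    · intro b _ hb
      rw [if_neg]
      rintro rfl
      exact hb rfl
    · simp
  · refine Finset.sum_eq_zero fun i _ => if_neg fun hj => h ?_
    rw [hj]; exact i.2

theorem lowPoly_degree_lt {a : ℕ} (u : Fin a → ℝ) : (lowPoly u).degree < a := by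
  rw [degree_lt_iff_coeff_zero]
  intro j hj
  rw [lowPoly_coeff, dif_neg (by omega)]

theorem lowPoly_add_smul {a : ℕ} (u v : Fin a → ℝ) (s : ℝ) :
    lowPoly (u + s • v) = lowPoly u + C s * lowPoly v := by
  ext j
  simp only [coeff_add, coeff_C_mul, lowPoly_coeff]
  split_ifs <;> simp

theorem lowPoly_eq_zero {a : ℕ} {u : Fin a → ℝ} (h : lowPoly u = 0) : u = 0 := by
  ext i
  have := lowPoly_coeff u i
  simpa [h] using this.symm

/-- The monic polynomial of degree `a` with the given lower coefficients. -/
noncomputable def monicPoly {a : ℕ} (u : Fin a → ℝ) : ℝ[X] := X ^ a + lowPoly u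

theorem monicPoly_monic {a : ℕ} (u : Fin a → ℝ) : (monicPoly u).Monic :=
  monic_X_pow_add (lowPoly_degree_lt u)

theorem monicPoly_natDegree {a : ℕ} (u : Fin a → ℝ) : (monicPoly u).natDegree = a :=
  natDegree_eq_of_degree_eq_some (by
    rw [monicPoly, degree_add_eq_left_of_degree_lt] <;> rw [degree_X_pow]
    exact lowPoly_degree_lt u)

theorem monicPoly_coeff {p : ℝ[X]} {a : ℕ} (hp : p.Monic) (ha : p.natDegree = a) :
    monicPoly (fun i : Fin a => p.coeff i) = p := by
  ext j
  rw [monicPoly, coeff_add, coeff_X_pow, lowPoly_coeff]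
  rcases lt_trichotomy j a with h | h | h
  · simp [h, h.ne]
  · subst h
    simpa [← ha] using hp.coeff_natDegree.symm
  · rw [if_neg h.ne', dif_neg (by omega), coeff_eq_zero_of_natDegree_lt (by omega), add_zero]

theorem monicPoly_add_smul {a : ℕ} (u v : Fin a → ℝ) (s : ℝ) :
    monicPoly (u + s • v) = monicPoly u + C s * lowPoly v := by
  rw [monicPoly, monicPoly, lowPoly_add_smul, add_assoc]

/-- The lower coefficients of the product of two monic polynomials. -/
noncomputable def mulCoeffs (a b : ℕ) (w : (Fin a → ℝ) × (Fin b → ℝ)) : Fin (a + b) → ℝ :=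
  fun i => (monicPoly w.1 * monicPoly w.2).coeff i

theorem contDiff_monicPoly_coeff {E : Type*} [NormedAddCommGroup E] [NormedSpace ℝ E] {a : ℕ}
    {g : E → Fin a → ℝ} {n : WithTop ℕ∞} (hg : ContDiff ℝ n g) (j : ℕ) :
    ContDiff ℝ n fun x => (monicPoly (g x)).coeff j := by
  simp only [monicPoly, coeff_add, lowPoly_coeff]
  refine contDiff_const.add ?_
  split_ifs with h
  · exact contDiff_pi.1 hg _
  · exact contDiff_const

theorem contDiff_mulCoeffs (a b : ℕ) (n : WithTop ℕ∞) : ContDiff ℝ n (mulCoeffs a b) := by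
  refine contDiff_pi.2 fun i => ?_
  simp only [mulCoeffs, coeff_mul]
  exact ContDiff.sum fun j _ => (contDiff_monicPoly_coeff contDiff_fst _).mul
    (contDiff_monicPoly_coeff contDiff_snd _)

/-- Along the line `w + s • h` the product is quadratic in `s`; its linear coefficient is the
derivative. -/
theorem fderiv_mulCoeffs_apply (a b : ℕ) (w h : (Fin a → ℝ) × (Fin b → ℝ)) (i : Fin (a + b)) :
    fderiv ℝ (mulCoeffs a b) w h i =
      (lowPoly h.1 * monicPoly w.2 + monicPoly w.1 * lowPoly h.2).coeff i := by
  have hd : HasFDerivAt (mulCoeffs a b) (fderiv ℝ (mulCoeffs a b) w) w :=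
    ((contDiff_mulCoeffs a b 1).differentiable one_ne_zero w).hasFDerivAt
  have h1 : HasDerivAt (fun s : ℝ => mulCoeffs a b (w + s • h) i)
      (fderiv ℝ (mulCoeffs a b) w h i) 0 :=
    (hasDerivAt_pi.1 (hd.hasLineDerivAt h)) i
  have h2 : (fun s : ℝ => mulCoeffs a b (w + s • h) i) = fun s =>
      (monicPoly w.1 * monicPoly w.2).coeff i +
      s * (lowPoly h.1 * monicPoly w.2 + monicPoly w.1 * lowPoly h.2).coeff i +
      s ^ 2 * (lowPoly h.1 * lowPoly h.2).coeff i := by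
    ext s
    simp only [mulCoeffs, Prod.fst_add, Prod.snd_add, Prod.smul_fst, Prod.smul_snd,
      monicPoly_add_smul]
    rw [← coeff_C_mul, ← coeff_C_mul, ← coeff_add, ← coeff_add, C_pow]
    congr 1
    ring
  rw [h2] at h1
  refine h1.unique ?_
  have h3 := (((hasDerivAt_id (0 : ℝ)).mul_const
    ((lowPoly h.1 * monicPoly w.2 + monicPoly w.1 * lowPoly h.2).coeff i)).const_add
    ((monicPoly w.1 * monicPoly w.2).coeff i)).fun_add
    (((hasDerivAt_id (0 : ℝ)).pow 2).mul_const ((lowPoly h.1 * lowPoly h.2).coeff i))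
  simpa using h3

/-- Invertibility of the Sylvester matrix: if `u * S + Q * v = 0` with `Q`, `S` coprime, then `Q`
divides `u`, which has smaller degree, so `u = 0` and then `v = 0`. -/
theorem fderiv_mulCoeffs_injective {a b : ℕ} {w : (Fin a → ℝ) × (Fin b → ℝ)}
    (hw : IsCoprime (monicPoly w.1) (monicPoly w.2)) :
    Function.Injective (fderiv ℝ (mulCoeffs a b) w) := by
  rw [injective_iff_map_eq_zero]
  intro h hh
  have h0 : lowPoly h.1 * monicPoly w.2 + monicPoly w.1 * lowPoly h.2 = 0 := by
    ext j
    by_cases hj : j < a + b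
    · simpa [fderiv_mulCoeffs_apply] using congrFun hh ⟨j, hj⟩
    · have hd : (lowPoly h.1 * monicPoly w.2 + monicPoly w.1 * lowPoly h.2).degree <
          ((a + b : ℕ) : WithBot ℕ) := by
        have e1 : (monicPoly w.1).degree = a := by
          rw [degree_eq_natDegree (monicPoly_monic _).ne_zero, monicPoly_natDegree]
        have e2 : (monicPoly w.2).degree = b := by
          rw [degree_eq_natDegree (monicPoly_monic _).ne_zero, monicPoly_natDegree]
        refine (degree_add_le _ _).trans_lt (max_lt ?_ ?_)
        · rw [degree_mul, e2, Nat.cast_add]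
          exact WithBot.add_lt_add_right (by simp) (lowPoly_degree_lt _)
        · rw [degree_mul, e1, Nat.cast_add]
          exact WithBot.add_lt_add_left (by simp) (lowPoly_degree_lt _)
      rw [coeff_eq_zero_of_degree_lt (hd.trans_le (by exact_mod_cast not_lt.1 hj)), coeff_zero]
  have z1 : lowPoly h.1 = 0 := by
    have hdvd : monicPoly w.1 ∣ lowPoly h.1 * monicPoly w.2 :=
      ⟨-lowPoly h.2, by rw [mul_neg]; exact eq_neg_of_add_eq_zero_left h0⟩
    refine eq_zero_of_dvd_of_degree_lt (hw.dvd_of_dvd_mul_right hdvd) ?_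
    rw [degree_eq_natDegree (monicPoly_monic _).ne_zero, monicPoly_natDegree]
    exact lowPoly_degree_lt _
  have z2 : lowPoly h.2 = 0 := by
    rw [z1, zero_mul, zero_add] at h0
    exact (mul_eq_zero.1 h0).resolve_left (monicPoly_monic _).ne_zero
  exact Prod.ext (lowPoly_eq_zero z1) (lowPoly_eq_zero z2)

/-- Analytic Hensel lemma: a coprime factorization at `0` of an analytic family of monic
polynomials extends to nearby parameters. -/
theorem CoeffAnalytic.exists_factorization {P : ℝ → ℝ[X]} (hP : CoeffAnalytic P) {a b : ℕ}
    (hmonic : ∀ᶠ t in 𝓝 0, (P t).Monic ∧ (P t).natDegree = a + b) {q s : ℝ[X]}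
    (hq : q.Monic) (hs : s.Monic) (hqa : q.natDegree = a) (hsb : s.natDegree = b)
    (hqs : IsCoprime q s) (h0 : P 0 = q * s) :
    ∃ Q S : ℝ → ℝ[X], CoeffAnalytic Q ∧ CoeffAnalytic S ∧
      (∀ t, (Q t).Monic ∧ (Q t).natDegree = a) ∧ (∀ t, (S t).Monic ∧ (S t).natDegree = b) ∧
      ∀ᶠ t in 𝓝 0, P t = Q t * S t := by
  set w : (Fin a → ℝ) × (Fin b → ℝ) := (fun i => q.coeff i, fun i => s.coeff i) with hw
  have hw1 : monicPoly w.1 = q := monicPoly_coeff hq hqa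
  have hw2 : monicPoly w.2 = s := monicPoly_coeff hs hsb
  have hinj : Function.Injective (fderiv ℝ (mulCoeffs a b) w) :=
    fderiv_mulCoeffs_injective (by rwa [hw1, hw2])
  -- Both sides have dimension `a + b`, so the injective derivative is an isomorphism and the
  -- inverse function theorem applies.
  let e : ((Fin a → ℝ) × (Fin b → ℝ)) ≃L[ℝ] (Fin (a + b) → ℝ) :=
    (LinearEquiv.ofInjectiveOfFinrankEq (fderiv ℝ (mulCoeffs a b) w).toLinearMap hinj
      (by simp)).toContinuousLinearEquiv
  have hd : HasFDerivAt (mulCoeffs a b) (e : _ →L[ℝ] _) w :=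
    ((contDiff_mulCoeffs a b 1).differentiable one_ne_zero w).hasFDerivAt
  -- Here `⊤ : WithTop ℕ∞` is the exponent `ω`, so the local inverse is analytic, not merely smooth.
  have hc : ContDiffAt ℝ ⊤ (mulCoeffs a b) w := (contDiff_mulCoeffs a b ⊤).contDiffAt
  let ψ := hc.localInverse hd (by simp)
  let γ : ℝ → Fin (a + b) → ℝ := fun t i => (P t).coeff i
  have hγ : ContDiffAt ℝ ⊤ γ 0 := contDiffAt_pi.2 fun i => (hP i).contDiffAt
  have hγ0 : γ 0 = mulCoeffs a b w := by
    ext i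
    simp only [γ, mulCoeffs, h0, hw1, hw2]
  have hψ : ContDiffAt ℝ ⊤ (fun t => ψ (γ t)) 0 :=
    ContDiffAt.comp (g := ψ) (0 : ℝ) (by rw [hγ0]; exact hc.to_localInverse hd (by simp)) hγ
  have hinv : ∀ᶠ t in 𝓝 0, mulCoeffs a b (ψ (γ t)) = γ t := by
    have := (hc.hasStrictFDerivAt' hd (by simp)).eventually_right_inverse
    rw [← hγ0] at this
    exact hγ.continuousAt.eventually this
  have hcoef : ∀ {c : ℕ} (g : ℝ → Fin c → ℝ), ContDiffAt ℝ ⊤ g 0 →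
      CoeffAnalytic fun t => monicPoly (g t) := by
    intro c g hg j
    have := (contDiff_monicPoly_coeff (n := ⊤) (contDiff_id (E := Fin c → ℝ)) j).contDiffAt.comp
      (0 : ℝ) hg
    exact this.analyticAt
  refine ⟨fun t => monicPoly (ψ (γ t)).1, fun t => monicPoly (ψ (γ t)).2,
    hcoef _ hψ.fst, hcoef _ hψ.snd, fun t => ⟨monicPoly_monic _, monicPoly_natDegree _⟩,
    fun t => ⟨monicPoly_monic _, monicPoly_natDegree _⟩, ?_⟩
  filter_upwards [hmonic, hinv] with t ht ht'
  have hm : (monicPoly (ψ (γ t)).1 * monicPoly (ψ (γ t)).2).Monic :=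
    (monicPoly_monic _).mul (monicPoly_monic _)
  have hn : (monicPoly (ψ (γ t)).1 * monicPoly (ψ (γ t)).2).natDegree = a + b := by
    rw [(monicPoly_monic _).natDegree_mul (monicPoly_monic _), monicPoly_natDegree,
      monicPoly_natDegree]
  rw [← monicPoly_coeff ht.1 ht.2, ← monicPoly_coeff hm hn]
  exact congrArg monicPoly ht'.symm

/-! ### Power sums and orders of vanishing -/

theorem Multiset.sum_map_sq_eq (s : Multiset ℝ) :
    (s.map (· ^ 2)).sum = s.sum ^ 2 - 2 * s.esymm 2 := by
  induction s using Multiset.induction_on with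
  | empty => simp [Multiset.esymm, Multiset.powersetCard_zero_right]
  | cons a s ih =>
    have h : (a ::ₘ s).esymm 2 = s.esymm 2 + a * s.sum := by
      simp only [Multiset.esymm, Multiset.powersetCard_cons, Multiset.powersetCard_one,
        Multiset.map_add, Multiset.map_map, Multiset.sum_add, Function.comp_def,
        Multiset.prod_cons, Multiset.prod_singleton]
      rw [Multiset.sum_map_mul_left, Multiset.map_id']
    rw [Multiset.map_cons, Multiset.sum_cons, Multiset.sum_cons, ih, h]
    ring

theorem Multiset.exists_fin_map_eq {α : Type*} {n : ℕ} (s : Multiset α)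
    (hs : Multiset.card s = n) : ∃ x : Fin n → α, Finset.univ.val.map x = s := by
  obtain ⟨l, rfl⟩ := Quot.exists_rep s
  subst hs
  refine ⟨l.get, ?_⟩
  have h : Finset.univ.val.map l.get = (List.ofFn l.get : Multiset α) := Fin.univ_val_map l.get
  rw [List.ofFn_get] at h
  exact h

theorem AnalyticAt.exists_eq_pow_mul_of_abs_le {f : ℝ → ℝ} (hf : AnalyticAt ℝ f 0) {s : ℕ}
    {K : ℝ} (hK : ∀ᶠ t in 𝓝 0, |f t| ≤ K * |t| ^ s) :
    ∃ g : ℝ → ℝ, AnalyticAt ℝ g 0 ∧ ∀ᶠ t in 𝓝 0, f t = t ^ s * g t := by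
  suffices h : (s : ℕ∞) ≤ analyticOrderAt f 0 by
    simpa using (natCast_le_analyticOrderAt hf).1 h
  by_contra! h
  obtain ⟨d, hd⟩ := ENat.ne_top_iff_exists.1 h.ne_top
  rw [← hd, Nat.cast_lt] at h
  obtain ⟨g, hg, hg0, hfg⟩ := hf.analyticOrderAt_eq_natCast.1 hd.symm
  refine hg0 (abs_eq_zero.1 (le_antisymm ?_ (abs_nonneg _)))
  have h1 : Tendsto (fun t => |g t|) (𝓝[≠] 0) (𝓝 |g 0|) :=
    hg.continuousAt.abs.tendsto.mono_left nhdsWithin_le_nhds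
  have h2 : Tendsto (fun t : ℝ => K * |t| ^ (s - d)) (𝓝[≠] 0) (𝓝 0) := by
    have : ContinuousAt (fun t : ℝ => K * |t| ^ (s - d)) 0 := by fun_prop
    have h3 := this.tendsto.mono_left (nhdsWithin_le_nhds (s := {0}ᶜ))
    simpa [Nat.sub_ne_zero_of_lt h] using h3
  refine le_of_tendsto_of_tendsto h1 h2 ?_
  filter_upwards [self_mem_nhdsWithin, nhdsWithin_le_nhds hK, nhdsWithin_le_nhds hfg]
    with t ht hKt hft
  have ht' : 0 < |t| ^ d := pow_pos (abs_pos.2 ht) d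
  rw [hft, sub_zero, smul_eq_mul, abs_mul, abs_pow, ← Nat.add_sub_of_le h.le, pow_add] at hKt
  refine le_of_mul_le_mul_left ?_ ht'
  calc _ ≤ _ := hKt
    _ = _ := by ring

/-- The sign to the right of `0` makes the leading coefficient positive; the sign to the left makes
the order even. Evenness is what rules out fractional powers of `t` in the roots. -/
theorem AnalyticAt.eventually_eq_zero_or_eq_even_pow_mul {q : ℝ → ℝ} (hq : AnalyticAt ℝ q 0)
    (hq0 : ∀ᶠ t in 𝓝 0, 0 ≤ q t) :
    (∀ᶠ t in 𝓝 0, q t = 0) ∨ ∃ (r : ℕ) (u : ℝ → ℝ), AnalyticAt ℝ u 0 ∧ 0 < u 0 ∧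
      ∀ᶠ t in 𝓝 0, q t = t ^ (2 * r) * u t := by
  by_cases h : analyticOrderAt q 0 = ⊤
  · exact Or.inl (analyticOrderAt_eq_top.1 h)
  right
  obtain ⟨d, hd⟩ := ENat.ne_top_iff_exists.1 h
  obtain ⟨u, hu, hu0, hqu⟩ := hq.analyticOrderAt_eq_natCast.1 hd.symm
  simp only [sub_zero, smul_eq_mul] at hqu
  have hu1 : 0 < u 0 := by
    refine lt_of_le_of_ne ?_ hu0.symm
    refine ge_of_tendsto
      (hu.continuousAt.tendsto.mono_left (nhdsWithin_le_nhds (s := Set.Ioi 0))) ?_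
    filter_upwards [self_mem_nhdsWithin, nhdsWithin_le_nhds hq0, nhdsWithin_le_nhds hqu]
      with t ht h1 h2
    rw [h2] at h1
    exact nonneg_of_mul_nonneg_right h1 (pow_pos ht d)
  have heven : Even d := by
    by_contra hodd
    rw [Nat.not_even_iff_odd] at hodd
    have hev : ∀ᶠ t in 𝓝[<] (0 : ℝ), False := by
      filter_upwards [self_mem_nhdsWithin, nhdsWithin_le_nhds hq0, nhdsWithin_le_nhds hqu,
        nhdsWithin_le_nhds (hu.continuousAt.eventually (lt_mem_nhds hu1))] with t ht h1 h2 h3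
      rw [h2] at h1
      exact absurd h1 (not_le.2 (mul_neg_of_neg_of_pos (hodd.pow_neg ht) h3))
    simpa using hev.exists
  obtain ⟨r, hr⟩ := heven
  exact ⟨r, u, hu, hu1, by rwa [two_mul, ← hr]⟩

theorem eq_of_eventually_pow_mul_eq {f g : ℝ → ℝ} (hf : ContinuousAt f 0) (hg : ContinuousAt g 0)
    {s : ℕ} (h : ∀ᶠ t in 𝓝 0, t ^ s * f t = t ^ s * g t) : f 0 = g 0 := by
  refine tendsto_nhds_unique_of_eventuallyEq
    (hf.tendsto.mono_left (nhdsWithin_le_nhds (s := {0}ᶜ)))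
    (hg.tendsto.mono_left nhdsWithin_le_nhds) ?_
  filter_upwards [self_mem_nhdsWithin, nhdsWithin_le_nhds h] with t ht h1
  exact mul_left_cancel₀ (pow_ne_zero s ht) h1

/-! ### Analytic roots of real-rooted families -/

theorem continuous_coeff_prod_X_sub_C {ι : Type*} (s : Finset ι) (j : ℕ) :
    Continuous fun x : ι → ℝ => (∏ i ∈ s, (X - C (x i))).coeff j := by
  classical
  induction s using Finset.induction_on generalizing j with
  | empty => simpa using continuous_const
  | insert a s ha ih =>
    simp only [Finset.prod_insert ha, coeff_mul, coeff_sub, coeff_C]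
    refine continuous_finsetSum _ fun k _ => Continuous.mul ?_ (ih _)
    refine continuous_const.sub ?_
    split_ifs
    · exact continuous_apply a
    · exact continuous_const

/-- A limit of monic real-rooted polynomials with uniformly bounded roots is real-rooted. -/
theorem CoeffAnalytic.splits_zero {P : ℝ → ℝ[X]} (hP : CoeffAnalytic P) {n : ℕ} {B : ℝ}
    (h : ∀ᶠ t in 𝓝[≠] 0, (P t).Monic ∧ (P t).natDegree = n ∧ (P t).Splits ∧
      ∀ x ∈ (P t).roots, |x| ≤ B) : (P 0).Splits := by
  let Φ : (Fin n → ℝ) → ℕ → ℝ := fun x j => (∏ i, (X - C (x i))).coeff j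
  have hΦ : Continuous Φ := continuous_pi fun j => continuous_coeff_prod_X_sub_C _ j
  -- The coefficient sequences of polynomials with all roots in `[-B, B]` form a compact, hence
  -- closed, set.
  have hclosed : IsClosed (Φ '' (Set.Icc (fun _ => -B) (fun _ => B))) :=
    (isCompact_Icc.image hΦ).isClosed
  have hmem : (fun j => (P 0).coeff j) ∈ Φ '' (Set.Icc (fun _ => -B) (fun _ => B)) := by
    refine hclosed.mem_of_tendsto (b := 𝓝[≠] (0 : ℝ)) (f := fun t j => (P t).coeff j) ?_ ?_
    · exact tendsto_pi_nhds.2 fun j =>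
        (hP j).continuousAt.tendsto.mono_left nhdsWithin_le_nhds
    · filter_upwards [h] with t ⟨h1, h2, h3, h4⟩
      obtain ⟨x, hx⟩ := Multiset.exists_fin_map_eq (P t).roots
        (h3.natDegree_eq_card_roots.symm.trans h2)
      have hxB : ∀ i, |x i| ≤ B := fun i => h4 _ (by
        rw [← hx]
        exact Multiset.mem_map_of_mem x (Finset.mem_univ i))
      refine ⟨x, ⟨fun i => (abs_le.1 (hxB i)).1, fun i => (abs_le.1 (hxB i)).2⟩, ?_⟩
      have hprod : P t = ∏ i, (X - C (x i)) := by
        rw [h3.eq_prod_roots_of_monic h1, ← hx, Multiset.map_map]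
        rfl
      ext j
      simp only [Φ, hprod]
  obtain ⟨x, -, hx⟩ := hmem
  have h0 : P 0 = ∏ i, (X - C (x i)) := by
    ext j
    exact (congrFun hx j).symm
  rw [h0]
  exact Splits.prod fun i _ => Splits.X_sub_C _

/-- Near `0`, the roots of `P t` (with multiplicity) are given by functions analytic at `0`. -/
def HasAnalyticRoots (P : ℝ → ℝ[X]) : Prop :=
  ∃ F : Multiset (ℝ → ℝ), (∀ f ∈ F, AnalyticAt ℝ f 0) ∧
    ∀ᶠ t in 𝓝 0, P t = (F.map fun f => X - C (f t)).prod

namespace HasAnalyticRoots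

theorem of_mul {P Q S : ℝ → ℝ[X]} (hQ : HasAnalyticRoots Q) (hS : HasAnalyticRoots S)
    (h : ∀ᶠ t in 𝓝 0, P t = Q t * S t) : HasAnalyticRoots P := by
  obtain ⟨F, hF, hQF⟩ := hQ
  obtain ⟨G, hG, hSG⟩ := hS
  refine ⟨F + G, fun f hf => (Multiset.mem_add.1 hf).elim (hF f) (hG f), ?_⟩
  filter_upwards [h, hQF, hSG] with t h1 h2 h3
  rw [h1, h2, h3, Multiset.map_add, Multiset.prod_add]

theorem of_scaleRoots {P R : ℝ → ℝ[X]} (hR : HasAnalyticRoots R) {c : ℝ → ℝ}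
    (hc : AnalyticAt ℝ c 0) (h : ∀ᶠ t in 𝓝 0, P t = (R t).scaleRoots (c t)) :
    HasAnalyticRoots P := by
  obtain ⟨F, hF, hRF⟩ := hR
  refine ⟨F.map fun f t => c t * f t, ?_, ?_⟩
  · intro f hf
    obtain ⟨g, hg, rfl⟩ := Multiset.mem_map.1 hf
    exact hc.fun_mul (hF g hg)
  · filter_upwards [h, hRF] with t h1 h2
    rw [h1, h2, Multiset.map_map]
    clear * -
    induction F using Multiset.induction_on with
    | empty => simp
    | cons f F ih =>
      simp only [Multiset.map_cons, Multiset.prod_cons, mul_scaleRoots_of_noZeroDivisors, ih,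
        X_sub_C_scaleRoots, Function.comp_apply, mul_comm (c t)]

theorem of_comp_X_add_C {P : ℝ → ℝ[X]} {s : ℝ → ℝ} (hs : AnalyticAt ℝ s 0)
    (h : HasAnalyticRoots fun t => (P t).comp (X + C (s t))) : HasAnalyticRoots P := by
  obtain ⟨F, hF, hPF⟩ := h
  refine ⟨F.map fun f t => f t + s t, ?_, ?_⟩
  · intro f hf
    obtain ⟨g, hg, rfl⟩ := Multiset.mem_map.1 hf
    exact (hF g hg).fun_add hs
  · filter_upwards [hPF] with t ht
    have h1 : P t = ((P t).comp (X + C (s t))).comp (X - C (s t)) := by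
      rw [comp_assoc]
      simp
    rw [h1, ht, multiset_prod_comp, Multiset.map_map, Multiset.map_map]
    congr 1
    refine Multiset.map_congr rfl fun f _ => ?_
    simp only [Function.comp_apply, sub_comp, X_comp, C_comp, C_add]
    ring

end HasAnalyticRoots

theorem sum_sq_roots_of_coeff_eq_zero {p : ℝ[X]} {n : ℕ} (hm : p.Monic)
    (hn : p.natDegree = n + 2) (hs : p.Splits) (h0 : p.coeff (n + 1) = 0) :
    (p.roots.map (· ^ 2)).sum = -2 * p.coeff n := by
  have hc : Multiset.card p.roots = n + 2 := hs.natDegree_eq_card_roots.symm.trans hn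
  have h1 := coeff_eq_esymm_roots_of_splits hs (k := n + 1) (by omega)
  have h2 := coeff_eq_esymm_roots_of_splits hs (k := n) (by omega)
  rw [hm.leadingCoeff, hn] at h1 h2
  have e1 : n + 2 - (n + 1) = 1 := by omega
  have e2 : n + 2 - n = 2 := by omega
  rw [e1, h0] at h1
  rw [e2] at h2
  have h3 : p.roots.sum = 0 := by
    simpa [Multiset.esymm, Multiset.powersetCard_one] using h1
  rw [Multiset.sum_map_sq_eq, h3, h2]
  ring

theorem coeff_comp_X_add_C_of_splits {p : ℝ[X]} {n : ℕ} (hm : p.Monic)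
    (hn : p.natDegree = n + 1) (hs : p.Splits) (c : ℝ) :
    (p.comp (X + C c)).coeff n = p.coeff n + (n + 1) * c := by
  have hc : Multiset.card p.roots = n + 1 := hs.natDegree_eq_card_roots.symm.trans hn
  have key : ∀ s : Multiset ℝ, Multiset.card s = n + 1 →
      (s.map fun x => X - C x).prod.coeff n = -s.sum := fun s hs' => by
    have := multiset_prod_X_sub_C_coeff_card_pred s (by omega)
    rwa [hs', Nat.add_sub_cancel] at this
  have h1 : p.comp (X + C c) = ((p.roots.map (· - c)).map fun x => X - C x).prod := by
    conv_lhs => rw [hs.eq_prod_roots_of_monic hm]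
    rw [multiset_prod_comp, Multiset.map_map, Multiset.map_map]
    congr 1
    refine Multiset.map_congr rfl fun x _ => ?_
    simp only [Function.comp_apply, sub_comp, X_comp, C_comp, C_sub]
    ring
  have h2 : p.coeff n = -p.roots.sum := by
    conv_lhs => rw [hs.eq_prod_roots_of_monic hm]
    exact key _ hc
  rw [h1, h2, key _ (by simpa using hc), Multiset.sum_map_sub, Multiset.map_id',
    Multiset.map_const', Multiset.sum_replicate, hc, nsmul_eq_mul]
  push_cast
  ring

/-- With root sum `0`, the sum of squared roots is `-2 * coeff n`: analytic and nonnegative, so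
either identically `0` or `t ^ (2 * r) * u t` with `u 0 > 0`. In the second case every root is `O(t
^ r)`; the roots divided by `t ^ r` belong to an analytic family `R`, and `R 0` has root sum `0` but
positive sum of squares. It thus has two distinct roots and splits into coprime factors of smaller
degree. -/
theorem CoeffAnalytic.hasAnalyticRoots_of_centered {n : ℕ} {P : ℝ → ℝ[X]} (hP : CoeffAnalytic P)
    (h : ∀ᶠ t in 𝓝 0, (P t).Monic ∧ (P t).natDegree = n + 2 ∧ (P t).Splits)
    (hcen : ∀ᶠ t in 𝓝 0, (P t).coeff (n + 1) = 0)
    (ih : ∀ k < n + 2, ∀ Q : ℝ → ℝ[X], CoeffAnalytic Q →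
      (∀ᶠ t in 𝓝 0, (Q t).Monic ∧ (Q t).natDegree = k ∧ (Q t).Splits) → HasAnalyticRoots Q) :
    HasAnalyticRoots P := by
  have hsq : ∀ᶠ t in 𝓝 0, ((P t).roots.map (· ^ 2)).sum = -2 * (P t).coeff n := by
    filter_upwards [h, hcen] with t ⟨h1, h2, h3⟩ h4
    exact sum_sq_roots_of_coeff_eq_zero h1 h2 h3 h4
  have hle : ∀ᶠ t in 𝓝 0, ∀ x ∈ (P t).roots, x ^ 2 ≤ -2 * (P t).coeff n := by
    filter_upwards [hsq] with t ht x hx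
    rw [← ht]
    refine Multiset.single_le_sum ?_ _ (Multiset.mem_map_of_mem (· ^ 2) hx)
    intro y hy
    obtain ⟨z, -, rfl⟩ := Multiset.mem_map.1 hy
    exact sq_nonneg z
  have hnn : ∀ᶠ t in 𝓝 0, 0 ≤ -2 * (P t).coeff n := by
    filter_upwards [hsq] with t ht
    rw [← ht]
    refine Multiset.sum_nonneg fun y hy => ?_
    obtain ⟨z, -, rfl⟩ := Multiset.mem_map.1 hy
    exact sq_nonneg z
  obtain hzero | ⟨r, u, hu, hu0, hqu⟩ :=
    AnalyticAt.eventually_eq_zero_or_eq_even_pow_mul (analyticAt_const.fun_mul (hP n)) hnn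
  · refine ⟨Multiset.replicate (n + 2) fun _ => 0, ?_, ?_⟩
    · intro f hf
      rw [Multiset.eq_of_mem_replicate hf]
      exact analyticAt_const
    · filter_upwards [h, hle, hzero] with t ⟨h1, h2, h3⟩ h4 h5
      have hr : (P t).roots = Multiset.replicate (n + 2) 0 := by
        refine Multiset.eq_replicate.2 ⟨h3.natDegree_eq_card_roots.symm.trans h2, fun x hx => ?_⟩
        have := h4 x hx
        rw [h5] at this
        exact pow_eq_zero_iff two_ne_zero |>.1 (le_antisymm this (sq_nonneg x))
      rw [h3.eq_prod_roots_of_monic h1, hr]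
      simp
  -- Near `0`, `u t < u 0 + 1`, so each root satisfies `x ^ 2 ≤ t ^ (2 * r) * u t ≤ (B * |t| ^ r) ^
  -- 2`.
  set B : ℝ := Real.sqrt (u 0 + 1) with hB
  have hroot : ∀ᶠ t in 𝓝 0, ∀ x ∈ (P t).roots, |x| ≤ B * |t| ^ r := by
    filter_upwards [hle, hqu, hu.continuousAt.eventually (gt_mem_nhds (lt_add_one (u 0)))]
      with t h1 h2 h3 x hx
    have h4 := h1 x hx
    rw [h2] at h4
    refine abs_le_of_sq_le_sq ?_ (by positivity)
    rw [mul_pow, hB, Real.sq_sqrt (by positivity), ← pow_mul, mul_comm r 2, pow_mul, sq_abs,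
      ← pow_mul]
    refine h4.trans ?_
    rw [mul_comm]
    exact mul_le_mul_of_nonneg_right h3.le ((even_two_mul r).pow_nonneg t)
  -- Coefficient `j` is homogeneous of degree `n + 2 - j` in the roots, so it is divisible by that
  -- power of `t ^ r`.
  have hex : ∀ j : Fin (n + 2), ∃ b : ℝ → ℝ, AnalyticAt ℝ b 0 ∧
      ∀ᶠ t in 𝓝 0, (P t).coeff j = t ^ (r * (n + 2 - j)) * b t := by
    intro j
    refine (hP j).exists_eq_pow_mul_of_abs_le (K := B ^ (n + 2 - j) * (n + 2).choose j) ?_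
    filter_upwards [h, hroot] with t ⟨h1, h2, h3⟩ h4
    have := coeff_le_of_roots_le (f := RingHom.id ℝ) (p := P t) (B := B * |t| ^ r) j h1
      (by simpa using h3) (by simpa using h4)
    rw [Polynomial.map_id, h2, Real.norm_eq_abs, mul_pow, ← pow_mul] at this
    linarith
  choose b hb hPb using hex
  let R : ℝ → ℝ[X] := fun t => monicPoly fun j => b j t
  have hRcoeff : ∀ t (j : Fin (n + 2)), (R t).coeff j = b j t := by
    intro t j
    simp only [R, monicPoly, coeff_add, coeff_X_pow, lowPoly_coeff]
    simp [j.2, j.2.ne]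
  have hR : CoeffAnalytic R := by
    intro j
    simp only [R, monicPoly, coeff_add, lowPoly_coeff]
    refine analyticAt_const.fun_add ?_
    split_ifs
    · exact hb _
    · exact analyticAt_const
  have hRm : ∀ t, (R t).Monic := fun t => monicPoly_monic _
  have hRn : ∀ t, (R t).natDegree = n + 2 := fun t => monicPoly_natDegree _
  have hscale : ∀ᶠ t in 𝓝 0, P t = (R t).scaleRoots (t ^ r) := by
    filter_upwards [h, eventually_all.2 hPb] with t ⟨h1, h2, _⟩ h3
    rw [← monicPoly_coeff h1 h2, ← monicPoly_coeff ((monic_scaleRoots_iff (t ^ r)).2 (hRm t))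
      ((natDegree_scaleRoots _ _).trans (hRn t))]
    congr 1
    ext j
    rw [h3 j, coeff_scaleRoots, hRcoeff, hRn, ← pow_mul, mul_comm]
  refine HasAnalyticRoots.of_scaleRoots ?_ (analyticAt_id.fun_pow r) hscale
  have hRsplit' : ∀ᶠ t in 𝓝[≠] 0, (R t).Monic ∧ (R t).natDegree = n + 2 ∧ (R t).Splits ∧
      ∀ x ∈ (R t).roots, |x| ≤ B := by
    filter_upwards [self_mem_nhdsWithin, nhdsWithin_le_nhds h, nhdsWithin_le_nhds hscale,
      nhdsWithin_le_nhds hroot] with t ht ⟨h1, h2, h3⟩ h4 h5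
    have htr : t ^ r ≠ 0 := pow_ne_zero r ht
    have hRP : R t = (P t).scaleRoots (t ^ r)⁻¹ := by
      rw [h4, ← scaleRoots_mul, mul_inv_cancel₀ htr, scaleRoots_one]
    refine ⟨hRm t, hRn t, hRP ▸ h3.scaleRoots _, fun x hx => ?_⟩
    rw [hRP, roots_scaleRoots _ (inv_ne_zero htr).isUnit] at hx
    obtain ⟨y, hy, rfl⟩ := Multiset.mem_map.1 hx
    have := h5 y hy
    rw [abs_mul, abs_inv, abs_pow, inv_mul_le_iff₀ (pow_pos (abs_pos.2 ht) r), mul_comm]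
    exact this
  -- The rescaling can be inverted only for `t ≠ 0`; at `0` real-rootedness comes from the limit.
  have hR0 : (R 0).Splits := hR.splits_zero hRsplit'
  have hRsplit : ∀ᶠ t in 𝓝 0, (R t).Splits := by
    have := eventually_nhdsWithin_iff.1 hRsplit'
    filter_upwards [this] with t ht
    by_cases h0 : t = 0
    · rwa [h0]
    · exact (ht h0).2.2.1
  have hc1 : (R 0).coeff (n + 1) = 0 := by
    have e : (R 0).coeff (n + 1) = b ⟨n + 1, by omega⟩ 0 := hRcoeff 0 ⟨n + 1, by omega⟩
    rw [e]
    refine eq_of_eventually_pow_mul_eq (g := fun _ => 0) (s := r * (n + 2 - (n + 1)))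
      (hb _).continuousAt continuousAt_const ?_
    filter_upwards [hcen, hPb ⟨n + 1, by omega⟩] with t h1 h2
    rw [mul_zero, ← h2, ← h1]
  have hc2 : (R 0).coeff n = -u 0 / 2 := by
    have e : (R 0).coeff n = b ⟨n, by omega⟩ 0 := hRcoeff 0 ⟨n, by omega⟩
    rw [e]
    refine eq_of_eventually_pow_mul_eq (g := fun t => -u t / 2) (s := r * (n + 2 - n))
      (hb _).continuousAt (hu.continuousAt.neg.div_const 2) ?_
    filter_upwards [hqu, hPb ⟨n, by omega⟩] with t h1 h2
    have e2 : r * (n + 2 - n) = 2 * r := by rw [Nat.add_sub_cancel_left, mul_comm]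
    simp only [e2] at h2 ⊢
    linarith
  have hsum2 : ((R 0).roots.map (· ^ 2)).sum = u 0 := by
    rw [sum_sq_roots_of_coeff_eq_zero (hRm 0) (hRn 0) hR0 hc1, hc2]
    ring
  have hsum1 : (R 0).roots.sum = 0 := by
    have h1 := hR0.nextCoeff_eq_neg_sum_roots_of_monic (hRm 0)
    rw [nextCoeff_of_natDegree_pos (by rw [hRn]; omega), hRn] at h1
    have h2 : (R 0).coeff (n + 2 - 1) = 0 := hc1
    linarith
  obtain ⟨μ, hμ⟩ := hR0.exists_eval_eq_zero (by
    rw [degree_eq_natDegree (hRm 0).ne_zero, hRn]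
    exact_mod_cast (by omega : n + 2 ≠ 0))
  obtain ⟨s, hs, hdvd⟩ :=
    exists_eq_pow_rootMultiplicity_mul_and_not_dvd (R 0) (hRm 0).ne_zero μ
  set a := rootMultiplicity μ (R 0) with ha
  have ha0 : 0 < a := (rootMultiplicity_pos (hRm 0).ne_zero).2 hμ
  have hqm : ((X - C μ) ^ a).Monic := (monic_X_sub_C μ).pow a
  have hqn : ((X - C μ) ^ a).natDegree = a := by
    rw [(monic_X_sub_C μ).natDegree_pow, natDegree_X_sub_C, mul_one]
  have hsm : s.Monic := hqm.of_mul_monic_left (hs ▸ hRm 0)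
  have hsn : a + s.natDegree = n + 2 := by
    have := hqm.natDegree_mul hsm
    rw [← hs, hRn, hqn] at this
    exact this.symm
  -- Otherwise `μ` is the only root; root sum `0` gives `μ = 0`, against the positive sum of squares
  -- `u 0`.
  have hs0 : 0 < s.natDegree := by
    refine Nat.pos_of_ne_zero fun h0 => ?_
    rw [hsm.natDegree_eq_zero.1 h0, mul_one] at hs
    have hroots : (R 0).roots = Multiset.replicate a μ := by
      rw [hs, roots_pow, roots_X_sub_C, Multiset.nsmul_singleton]
    rw [hroots, Multiset.sum_replicate, nsmul_eq_mul] at hsum1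
    have hμ0 : μ = 0 := (mul_eq_zero.1 hsum1).resolve_left (by exact_mod_cast ha0.ne')
    rw [hroots, Multiset.map_replicate, Multiset.sum_replicate, hμ0] at hsum2
    simp at hsum2
    exact hu0.ne hsum2
  have hcop : IsCoprime ((X - C μ) ^ a) s :=
    ((irreducible_X_sub_C μ).coprime_iff_not_dvd.2 hdvd).pow_left
  obtain ⟨Q, S, hQ, hS, hQm, hSm, hRQS⟩ := hR.exists_factorization
    (Eventually.of_forall fun t => ⟨hRm t, (hRn t).trans hsn.symm⟩) hqm hsm hqn rfl hcop hs
  refine HasAnalyticRoots.of_mul (ih a (by omega) Q hQ ?_) (ih s.natDegree (by omega) S hS ?_) hRQS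
  · filter_upwards [hRQS, hRsplit] with t h1 h2
    exact ⟨(hQm t).1, (hQm t).2, h2.of_dvd (hRm t).ne_zero ⟨_, h1⟩⟩
  · filter_upwards [hRQS, hRsplit] with t h1 h2
    exact ⟨(hSm t).1, (hSm t).2, h2.of_dvd (hRm t).ne_zero ⟨Q t, by rw [h1, mul_comm]⟩⟩

/-- **Rellich's theorem**: the roots of an analytic one-parameter family of monic real-rooted
polynomials can be chosen analytically. -/
theorem CoeffAnalytic.hasAnalyticRoots {n : ℕ} {P : ℝ → ℝ[X]} (hP : CoeffAnalytic P)
    (h : ∀ᶠ t in 𝓝 0, (P t).Monic ∧ (P t).natDegree = n ∧ (P t).Splits) :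
    HasAnalyticRoots P := by
  induction n using Nat.strong_induction_on generalizing P with
  | _ n ih =>
    match n, ih with
    | 0, _ =>
      refine ⟨0, by simp, ?_⟩
      filter_upwards [h] with t ht
      simpa using ht.1.natDegree_eq_zero.1 ht.2.1
    | 1, _ =>
      refine ⟨{fun t => -(P t).coeff 0}, by simpa using (hP 0).fun_neg, ?_⟩
      filter_upwards [h] with t ht
      have := eq_X_add_C_of_natDegree_le_one ht.2.1.le
      have h1 : (P t).coeff 1 = 1 := by
        have := ht.1.coeff_natDegree
        rwa [ht.2.1] at this
      rw [h1] at this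
      simpa using this
    | n + 2, ih =>
      -- The shift is the mean of the roots, so the translated family is centered.
      have hs : AnalyticAt ℝ (fun t => -(P t).coeff (n + 1) / (n + 2 : ℝ)) 0 :=
        (hP (n + 1)).fun_neg.fun_div analyticAt_const (by positivity)
      refine HasAnalyticRoots.of_comp_X_add_C hs ?_
      refine (hP.comp_X_add_C (h.mono fun t ht => ht.2.1) hs).hasAnalyticRoots_of_centered
        (n := n) ?_ ?_ fun k hk Q hQ hQ' => ih k hk hQ hQ'
      · filter_upwards [h] with t ⟨h1, h2, h3⟩
        exact ⟨h1.comp_X_add_C _, by rw [natDegree_comp, natDegree_X_add_C, mul_one, h2],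
          h3.comp_X_add_C _⟩
      · filter_upwards [h] with t ⟨h1, h2, h3⟩
        rw [coeff_comp_X_add_C_of_splits h1 h2 h3]
        push_cast
        field_simp
        ring

/-! ### Ordered eigenvalues of analytic symmetric families -/

theorem AnalyticAt.exists_eventually_nonneg_iff {f : ℝ → ℝ} (hf : AnalyticAt ℝ f 0) :
    ∃ a : Prop, ∀ᶠ t in 𝓝[>] 0, (0 ≤ f t ↔ a) := by
  by_cases h : analyticOrderAt f 0 = ⊤
  · refine ⟨True, ?_⟩
    filter_upwards [nhdsWithin_le_nhds (analyticOrderAt_eq_top.1 h)] with t ht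
    simp [ht]
  · obtain ⟨d, hd⟩ := ENat.ne_top_iff_exists.1 h
    obtain ⟨u, hu, hu0, hfu⟩ := hf.analyticOrderAt_eq_natCast.1 hd.symm
    simp only [sub_zero, smul_eq_mul] at hfu
    refine ⟨0 ≤ u 0, ?_⟩
    rcases lt_or_gt_of_ne hu0 with h0 | h0
    · filter_upwards [self_mem_nhdsWithin, nhdsWithin_le_nhds hfu,
        nhdsWithin_le_nhds (hu.continuousAt.eventually (gt_mem_nhds h0))] with t h1 h2 h3
      rw [h2, mul_nonneg_iff_of_pos_left (pow_pos h1 d)]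
      exact iff_of_false h3.not_ge h0.not_ge
    · filter_upwards [self_mem_nhdsWithin, nhdsWithin_le_nhds hfu,
        nhdsWithin_le_nhds (hu.continuousAt.eventually (lt_mem_nhds h0))] with t h1 h2 h3
      rw [h2, mul_nonneg_iff_of_pos_left (pow_pos h1 d)]
      exact iff_of_true h3.le h0.le

/-- Finitely many functions analytic at `0` can be put in descending order to the right
of `0`. -/
theorem exists_perm_eventually_antitone {n : ℕ} {f : Fin n → ℝ → ℝ}
    (hf : ∀ i, AnalyticAt ℝ (f i) 0) :
    ∃ σ : Equiv.Perm (Fin n), ∀ᶠ t in 𝓝[>] 0, Antitone fun i => f (σ i) t := by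
  choose a ha using fun i j => ((hf i).fun_sub (hf j)).exists_eventually_nonneg_iff
  have hall : ∀ᶠ t in 𝓝[>] (0 : ℝ), ∀ i j, (0 ≤ f i t - f j t ↔ a i j) :=
    eventually_all.2 fun i => eventually_all.2 fun j => ha i j
  obtain ⟨t₀, ht₀⟩ := hall.exists
  -- All pairwise comparisons are constant in `t`, so sorting at the single point `t₀` sorts
  -- everywhere nearby.
  refine ⟨Tuple.sort fun i => -f i t₀, hall.mono fun t ht i j hij => ?_⟩
  have h := Tuple.monotone_sort (fun i => -f i t₀) hij
  simp only [Function.comp_apply] at h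
  exact sub_nonneg.1 ((ht _ _).2 ((ht₀ _ _).1 (by linarith)))

theorem CoeffAnalytic.charpoly {n : ℕ} {H : ℝ → Matrix (Fin n) (Fin n) ℝ}
    (hH : ∀ i j, AnalyticAt ℝ (fun t => H t i j) 0) : CoeffAnalytic fun t => (H t).charpoly := by
  simp only [Matrix.charpoly, Matrix.det_apply']
  refine CoeffAnalytic.sum _ fun σ _ => ?_
  have h : CoeffAnalytic fun t => ∏ i, (H t).charmatrix (σ i) i := by
    refine CoeffAnalytic.prod _ fun i _ => ?_
    simp only [Matrix.charmatrix_apply]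
    have h1 : CoeffAnalytic fun t => C (-H t (σ i) i) := CoeffAnalytic.of_C (hH _ _).fun_neg
    simpa only [C_neg, ← sub_eq_add_neg] using (CoeffAnalytic.const _).add h1
  exact (CoeffAnalytic.const _).mul h

/-- The ordered eigenvalues of an analytic family of real symmetric matrices agree with analytic
functions to the right of `0`. -/
theorem exists_analytic_eigenvalues {n : ℕ} {H : ℝ → Matrix (Fin n) (Fin n) ℝ}
    (hH : ∀ i j, AnalyticAt ℝ (fun t => H t i j) 0) (hherm : ∀ t, (H t).IsHermitian) :
    ∃ f : Fin n → ℝ → ℝ, (∀ l, AnalyticAt ℝ (f l) 0) ∧ ∀ᶠ t in 𝓝[>] 0, ∀ l : Fin n,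
      (hherm t).eigenvalues₀ (Fin.cast (Fintype.card_fin n).symm l) = f l t := by
  obtain ⟨F, hF, hPF⟩ := (CoeffAnalytic.charpoly hH).hasAnalyticRoots (n := n)
    (Eventually.of_forall fun t => ⟨Matrix.charpoly_monic _, by
      rw [Matrix.charpoly_natDegree_eq_dim, Fintype.card_fin], (hherm t).splits_charpoly⟩)
  have hroots : ∀ᶠ t in 𝓝 0, (H t).charpoly.roots = F.map fun f => f t := by
    filter_upwards [hPF] with t ht
    have h1 : F.map (fun f => X - C (f t)) = (F.map fun f => f t).map fun x => X - C x := by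
      rw [Multiset.map_map]; rfl
    rw [ht, h1, roots_multiset_prod_X_sub_C]
  have hcard : Multiset.card F = n := by
    have h1 := congrArg Multiset.card hroots.self_of_nhds
    rw [Multiset.card_map, ← (hherm 0).splits_charpoly.natDegree_eq_card_roots,
      Matrix.charpoly_natDegree_eq_dim, Fintype.card_fin] at h1
    exact h1.symm
  obtain ⟨g, hg⟩ := F.exists_fin_map_eq hcard
  have hga : ∀ i, AnalyticAt ℝ (g i) 0 := fun i => hF _ (by
    rw [← hg]; exact Multiset.mem_map_of_mem g (Finset.mem_univ i))
  obtain ⟨σ, hσ⟩ := exists_perm_eventually_antitone hga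
  refine ⟨fun l => g (σ l), fun l => hga _, ?_⟩
  filter_upwards [hσ, nhdsWithin_le_nhds hroots] with t h1 h2
  have h3 : (Finset.univ.val.map fun l : Fin n =>
      (hherm t).eigenvalues₀ (Fin.cast (Fintype.card_fin n).symm l)) =
      Finset.univ.val.map fun l => g l t := by
    have h4 := (hherm t).roots_charpoly_eq_eigenvalues₀
    rw [h2, ← hg, Multiset.map_map] at h4
    have h5 : (Finset.univ : Finset (Fin (Fintype.card (Fin n)))).val =
        (Finset.univ : Finset (Fin n)).val.map (Fin.cast (Fintype.card_fin n).symm) := by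
      have := Finset.map_univ_equiv (finCongr (Fintype.card_fin n).symm)
      rw [← this]; rfl
    rw [h5, Multiset.map_map] at h4
    exact h4.symm
  rw [Fin.univ_val_map, Fin.univ_val_map, Multiset.coe_eq_coe] at h3
  have h6 : Antitone fun l : Fin n =>
      (hherm t).eigenvalues₀ (Fin.cast (Fintype.card_fin n).symm l) :=
    fun i j hij => (hherm t).eigenvalues₀_antitone (by simpa using hij)
  -- Two descending lists that are permutations of each other coincide.
  have h7 := h3.trans (σ.ofFn_comp_perm fun l => g l t).symm
  exact congrFun (List.ofFn_injective (h7.eq_of_pairwise' h6.sortedGE_ofFn.pairwise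
    h1.sortedGE_ofFn.pairwise))

/-! ### Rayleigh quotient bounds -/

theorem exists_rayleigh_decomposition {n : ℕ} {A : Matrix (Fin n) (Fin n) ℝ} (hA : A.IsHermitian)
    (x : Fin n → ℝ) : ∃ y : Fin n → ℝ, x ⬝ᵥ x = ∑ i, y i ^ 2 ∧
      x ⬝ᵥ (A.mulVec x) = ∑ i, hA.eigenvalues i * y i ^ 2 := by
  have hsum : ∀ z w : Fin n → ℝ, z ⬝ᵥ w = ∑ i, ((hA.eigenvectorBasis i).ofLp ⬝ᵥ z) *
      ((hA.eigenvectorBasis i).ofLp ⬝ᵥ w) := by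
    intro z w
    have := hA.eigenvectorBasis.sum_inner_mul_inner (WithLp.toLp 2 z) (WithLp.toLp 2 w)
    simp only [EuclideanSpace.inner_eq_star_dotProduct, star_trivial] at this
    rw [dotProduct_comm, ← this]
    exact Finset.sum_congr rfl fun i _ => by rw [dotProduct_comm w]
  refine ⟨fun i => (hA.eigenvectorBasis i).ofLp ⬝ᵥ x, ?_, ?_⟩
  · rw [hsum x x]
    exact Finset.sum_congr rfl fun i _ => (sq _).symm
  · rw [hsum]
    refine Finset.sum_congr rfl fun i _ => ?_
    have h1 : (hA.eigenvectorBasis i).ofLp ⬝ᵥ A.mulVec x =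
        hA.eigenvalues i * ((hA.eigenvectorBasis i).ofLp ⬝ᵥ x) := by
      have hT : A.transpose = A := by
        rw [← Matrix.conjTranspose_eq_transpose_of_trivial]; exact hA.eq
      rw [Matrix.dotProduct_mulVec, ← Matrix.mulVec_transpose, hT, hA.mulVec_eigenvectorBasis,
        smul_dotProduct, smul_eq_mul]
    rw [h1]
    ring

theorem dotProduct_mulVec_le_of_eigenvalues_le {n : ℕ} {A : Matrix (Fin n) (Fin n) ℝ}
    (hA : A.IsHermitian) {M : ℝ} (hM : ∀ i, hA.eigenvalues i ≤ M) (x : Fin n → ℝ) :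
    x ⬝ᵥ (A.mulVec x) ≤ M * (x ⬝ᵥ x) := by
  obtain ⟨y, h1, h2⟩ := exists_rayleigh_decomposition hA x
  rw [h1, h2, Finset.mul_sum]
  exact Finset.sum_le_sum fun i _ => mul_le_mul_of_nonneg_right (hM i) (sq_nonneg _)

theorem le_dotProduct_mulVec_of_le_eigenvalues {n : ℕ} {A : Matrix (Fin n) (Fin n) ℝ}
    (hA : A.IsHermitian) {c : ℝ} (hc : ∀ i, c ≤ hA.eigenvalues i) (x : Fin n → ℝ) :
    c * (x ⬝ᵥ x) ≤ x ⬝ᵥ (A.mulVec x) := by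
  obtain ⟨y, h1, h2⟩ := exists_rayleigh_decomposition hA x
  rw [h1, h2, Finset.mul_sum]
  exact Finset.sum_le_sum fun i _ => mul_le_mul_of_nonneg_right (hc i) (sq_nonneg _)

theorem Matrix.PosDef.exists_pos_mul_le {n : ℕ} {A : Matrix (Fin n) (Fin n) ℝ} (hA : A.PosDef) :
    ∃ c : ℝ, 0 < c ∧ ∀ x : Fin n → ℝ, c * (x ⬝ᵥ x) ≤ x ⬝ᵥ (A.mulVec x) := by
  rcases isEmpty_or_nonempty (Fin n) with h | h
  · exact ⟨1, one_pos, fun x => by simp [dotProduct]⟩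
  · obtain ⟨i, hi⟩ := Finite.exists_min hA.1.eigenvalues
    exact ⟨hA.1.eigenvalues i, hA.eigenvalues_pos i,
      le_dotProduct_mulVec_of_le_eigenvalues hA.1 hi⟩

theorem le_eigenvalues_of_forall_le {n : ℕ} {A : Matrix (Fin n) (Fin n) ℝ}
    (hA : A.IsHermitian) {c : ℝ} (hc : ∀ x : Fin n → ℝ, c * (x ⬝ᵥ x) ≤ x ⬝ᵥ (A.mulVec x))
    (i : Fin n) : c ≤ hA.eigenvalues i := by
  have h := hc (hA.eigenvectorBasis i).ofLp
  have h1 : (hA.eigenvectorBasis i).ofLp ⬝ᵥ (hA.eigenvectorBasis i).ofLp = 1 := by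
    have := hA.eigenvectorBasis.inner_eq_one i
    rwa [EuclideanSpace.inner_eq_star_dotProduct, star_trivial] at this
  rwa [hA.mulVec_eigenvectorBasis, dotProduct_smul, h1, mul_one, smul_eq_mul, mul_one] at h

/-! ### Lattice sums and the Fourier form of the quadratic form -/

theorem powNorm_zero {m k : ℕ} (hk : k ≠ 0) : powNorm k (0 : Fin m → ℤ) = 0 := by
  simp [powNorm, hk]

theorem powNorm_nonneg {m : ℕ} (k : ℕ) (l : Fin m → ℤ) : 0 ≤ powNorm k l :=
  Finset.sum_nonneg fun _ _ => by positivity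

theorem abs_pow_le_powNorm {m : ℕ} (k : ℕ) (l : Fin m → ℤ) (i : Fin m) :
    |(l i : ℝ)| ^ (2 * k) ≤ powNorm k l :=
  Finset.single_le_sum (f := fun i => |(l i : ℝ)| ^ (2 * k)) (fun _ _ => by positivity)
    (Finset.mem_univ i)

theorem one_le_powNorm {m k : ℕ} {l : Fin m → ℤ} (hl : l ≠ 0) : 1 ≤ powNorm k l := by
  obtain ⟨i, hi⟩ := Function.ne_iff.1 hl
  refine le_trans (one_le_pow₀ ?_) (abs_pow_le_powNorm k l i)
  exact_mod_cast Int.one_le_abs hi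

/-- The lattice series of inverse powers of the norm converges above the dimension. -/
theorem summable_inv_powNorm {m k : ℕ} (hk : m < 2 * k) :
    Summable fun l : Fin m → ℤ => (powNorm k l)⁻¹ := by
  rcases isEmpty_or_nonempty (Fin m) with hm | hm
  · exact Summable.of_finite
  let L : Submodule ℤ (Fin m → ℝ) := Submodule.span ℤ (Set.range (Pi.basisFun ℝ (Fin m)))
  have hrank : Module.finrank ℤ L = m := by
    rw [ZLattice.rank ℝ L, Module.finrank_fin_fun]
  have hsum := ZLattice.summable_norm_pow_inv L (2 * k) (by rwa [hrank])
  have hmem : ∀ l : Fin m → ℤ, (fun i => (l i : ℝ)) ∈ L := fun l =>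
    ((Pi.basisFun ℝ (Fin m)).mem_span_iff_repr_mem ℤ _).2 fun i => ⟨l i, by simp⟩
  let φ : (Fin m → ℤ) → L := fun l => ⟨fun i => (l i : ℝ), hmem l⟩
  have hφ : Function.Injective φ := fun l l' h => by
    ext i
    have : (l i : ℝ) = l' i := congrFun (congrArg Subtype.val h) i
    exact_mod_cast this
  refine Summable.of_nonneg_of_le (fun l => inv_nonneg.2 (powNorm_nonneg k l)) (fun l => ?_)
    (hsum.comp_injective hφ)
  by_cases hl : l = 0
  · have hk0 : k ≠ 0 := by omega
    rw [hl, powNorm_zero hk0, inv_zero]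
    exact pow_nonneg (inv_nonneg.2 (norm_nonneg _)) _
  -- The largest coordinate realizes the sup norm, and its `2k`-th power is one term of `powNorm k
  -- l`.
  obtain ⟨i, hi⟩ := Finite.exists_max fun i => |(l i : ℝ)|
  have h1 : ‖φ l‖ ≤ |(l i : ℝ)| := (pi_norm_le_iff_of_nonneg (abs_nonneg _)).2 hi
  have h2 : 0 < ‖φ l‖ := by
    refine norm_pos_iff.2 fun h => hl (hφ (h.trans ?_))
    ext; simp [φ]
  rw [Function.comp_apply, inv_pow]
  refine inv_anti₀ (pow_pos h2 _) (le_trans ?_ (abs_pow_le_powNorm k l i))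
  gcongr

/-- The majorant for `kernelInv`: the inverse vanishes at `l = 0`, so the term there is restored by
hand. -/
theorem summable_single_add_inv_powNorm {m k : ℕ} (hk : m < 2 * k) :
    Summable fun l : Fin m → ℤ => (if l = 0 then (1 : ℝ) else 0) + (powNorm k l)⁻¹ :=
  (hasSum_ite_eq (0 : Fin m → ℤ) (1 : ℝ)).summable.add (summable_inv_powNorm hk)

theorem summable_weight {m k : ℕ} (hk : m < 2 * k) {lam : ℝ} (hlam : 0 < lam) :
    Summable fun l : Fin m → ℤ => 1 / (1 + lam * powNorm k l) := by
  refine Summable.of_norm_bounded_eventually ((summable_inv_powNorm hk).mul_left lam⁻¹) ?_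
  rw [Filter.eventually_cofinite]
  refine (Set.finite_singleton (0 : Fin m → ℤ)).subset fun l hl => ?_
  by_contra h0
  refine hl ?_
  have hN := one_le_powNorm (k := k) h0
  have : 0 < lam * powNorm k l := by positivity
  rw [Real.norm_of_nonneg (by positivity), ← mul_inv, one_div]
  exact inv_anti₀ this (by linarith)

/-- The phase of the character `l` at the point `x`. -/
noncomputable def phase {m : ℕ} (l : Fin m → ℤ) (x : Fin m → ℝ) : ℝ :=
  2 * Real.pi * ∑ i, (l i : ℝ) * x i

theorem phase_sub {m : ℕ} (l : Fin m → ℤ) (x y : Fin m → ℝ) :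
    phase l (x - y) = phase l x - phase l y := by
  simp only [phase, Pi.sub_apply, mul_sub, Finset.sum_sub_distrib]

theorem phase_add_left {m : ℕ} (l l' : Fin m → ℤ) (x : Fin m → ℝ) :
    phase (l + l') x = phase l x + phase l' x := by
  simp only [phase, Pi.add_apply, Int.cast_add, add_mul, Finset.sum_add_distrib, mul_add]

theorem phase_zero_left {m : ℕ} (x : Fin m → ℝ) : phase (0 : Fin m → ℤ) x = 0 := by
  simp [phase]

theorem hasSum_kernelG {m k : ℕ} (hk : m < 2 * k) {lam : ℝ} (hlam : 0 < lam) (x : Fin m → ℝ) :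
    HasSum (fun l : Fin m → ℤ => 1 / (1 + lam * powNorm k l) * Real.cos (phase l x))
      (kernelG k lam x) := by
  refine Summable.hasSum ((summable_weight hk hlam).of_norm_bounded fun l => ?_)
  have hN := powNorm_nonneg k l
  rw [norm_mul, Real.norm_of_nonneg (by positivity)]
  exact mul_le_of_le_one_right (by positivity) (Real.abs_cos_le_one _)

/-- The squared modulus of the Fourier coefficient at `l` of the measure `∑ i, x i • δ (p i)`. -/
noncomputable def fourierSq {m n : ℕ} (p : Fin n → Fin m → ℝ) (x : Fin n → ℝ) (l : Fin m → ℤ) :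
    ℝ :=
  (∑ i, x i * Real.cos (phase l (p i))) ^ 2 + (∑ i, x i * Real.sin (phase l (p i))) ^ 2

theorem fourierSq_nonneg {m n : ℕ} (p : Fin n → Fin m → ℝ) (x : Fin n → ℝ) (l : Fin m → ℤ) :
    0 ≤ fourierSq p x l := by
  unfold fourierSq; positivity

theorem hasSum_dotProduct_matG {m n k : ℕ} (hk : m < 2 * k) {lam : ℝ} (hlam : 0 < lam)
    (p : Fin n → Fin m → ℝ) (x : Fin n → ℝ) :
    HasSum (fun l : Fin m → ℤ => 1 / (1 + lam * powNorm k l) * fourierSq p x l)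
      (x ⬝ᵥ ((matG k p lam).mulVec x)) := by
  have h : HasSum (fun l : Fin m → ℤ => ∑ i, ∑ j,
      x i * (1 / (1 + lam * powNorm k l) * Real.cos (phase l (p i - p j)) * x j))
      (∑ i, ∑ j, x i * (kernelG k lam (p i - p j) * x j)) :=
    hasSum_sum fun i _ => hasSum_sum fun j _ =>
      ((hasSum_kernelG hk hlam (p i - p j)).mul_right (x j)).mul_left (x i)
  convert h using 1
  · ext l
    rw [fourierSq, sq, sq, Finset.sum_mul_sum, Finset.sum_mul_sum, ← Finset.sum_add_distrib,
      Finset.mul_sum]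
    refine Finset.sum_congr rfl fun i _ => ?_
    rw [← Finset.sum_add_distrib, Finset.mul_sum]
    refine Finset.sum_congr rfl fun j _ => ?_
    rw [phase_sub, Real.cos_sub]
    ring
  · simp only [dotProduct, Matrix.mulVec, matG, Matrix.of_apply, Finset.mul_sum]

/-- The character of `ℤ^m` given by a point of the torus. -/
noncomputable def torusChar {m : ℕ} (x : Fin m → ℝ) : Multiplicative (Fin m → ℤ) →* ℂ where
  toFun l := Complex.exp (phase l.toAdd x * Complex.I)
  map_one' := by simp [phase_zero_left]
  map_mul' a b := by
    rw [toAdd_mul, phase_add_left, Complex.ofReal_add, add_mul, Complex.exp_add]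

theorem torusChar_injective {m n : ℕ} {p : Fin n → Fin m → ℝ} (hp : DistinctOnTorus p) :
    Function.Injective fun i => torusChar (p i) := by
  intro i j hij
  by_contra hne
  refine hp i j hne ?_
  have h : ∀ t, ∃ z : ℤ, p i t - p j t = z := by
    intro t
    have h1 := DFunLike.congr_fun hij (Multiplicative.ofAdd (Pi.single t 1 : Fin m → ℤ))
    have hphase : ∀ x : Fin m → ℝ, phase (Pi.single t 1 : Fin m → ℤ) x = 2 * Real.pi * x t := by
      intro x
      simp [phase, Pi.single_apply]
    simp only [torusChar, MonoidHom.coe_mk, OneHom.coe_mk, toAdd_ofAdd, hphase] at h1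
    obtain ⟨z, hz⟩ := Complex.exp_eq_exp_iff_exists_int.1 h1
    refine ⟨z, ?_⟩
    have h2 : (2 * Real.pi * Complex.I) * ((p i t - p j t : ℝ) : ℂ) =
        (2 * Real.pi * Complex.I) * ((z : ℝ) : ℂ) := by
      push_cast at hz ⊢
      linear_combination hz
    exact_mod_cast mul_left_cancel₀ Complex.two_pi_I_ne_zero h2
  choose z hz using h
  exact ⟨z, hz⟩

/-- Dedekind's independence of characters, applied to the distinct characters `torusChar (p i)` of
`ℤ^m`. -/
theorem exists_fourierSq_pos {m n : ℕ} {p : Fin n → Fin m → ℝ} (hp : DistinctOnTorus p)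
    {x : Fin n → ℝ} (hx : x ≠ 0) : ∃ l : Fin m → ℤ, 0 < fourierSq p x l := by
  by_contra! h
  have hzero : ∀ l, fourierSq p x l = 0 := fun l => le_antisymm (h l) (fourierSq_nonneg p x l)
  have hli := (linearIndependent_monoidHom (Multiplicative (Fin m → ℤ)) ℂ).comp _
    (torusChar_injective hp)
  refine hx (funext fun i => ?_)
  have := Fintype.linearIndependent_iff.1 hli (fun i => (x i : ℂ)) ?_ i
  · exact_mod_cast this
  · ext l
    obtain ⟨hc, hs⟩ := (add_eq_zero_iff_of_nonneg (sq_nonneg _) (sq_nonneg _)).1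
      (hzero l.toAdd)
    rw [pow_eq_zero_iff two_ne_zero] at hc hs
    have e : ∀ i, (x i : ℂ) * Complex.exp (phase l.toAdd (p i) * Complex.I) =
        ((x i * Real.cos (phase l.toAdd (p i)) : ℝ) : ℂ) +
          ((x i * Real.sin (phase l.toAdd (p i)) : ℝ) : ℂ) * Complex.I := by
      intro i
      rw [Complex.exp_mul_I]
      push_cast
      ring
    simp only [Finset.sum_apply, Pi.smul_apply, Function.comp_apply, smul_eq_mul, torusChar,
      MonoidHom.coe_mk, OneHom.coe_mk, e, Finset.sum_add_distrib, ← Finset.sum_mul,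
      ← Complex.ofReal_sum, hc, hs, Pi.zero_apply]
    simp

theorem matG_posDef {m n k : ℕ} (hk : m < 2 * k) {p : Fin n → Fin m → ℝ} (hp : DistinctOnTorus p)
    {lam : ℝ} (hlam : 0 < lam) : (matG k p lam).PosDef := by
  refine Matrix.PosDef.of_dotProduct_mulVec_pos (matG_isHermitian k p lam) fun x hx => ?_
  obtain ⟨l, hl⟩ := exists_fourierSq_pos hp hx
  have hw : ∀ l : Fin m → ℤ, 0 < 1 / (1 + lam * powNorm k l) := fun l => by
    have := powNorm_nonneg k l
    positivity
  rw [star_trivial]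
  have h := hasSum_dotProduct_matG hk hlam p x
  rw [← h.tsum_eq]
  exact h.summable.tsum_pos (fun l => mul_nonneg (hw l).le (fourierSq_nonneg p x l)) l
    (mul_pos (hw l) hl)

theorem dotProduct_matG_one_le {m n k : ℕ} (hk : m < 2 * k) (p : Fin n → Fin m → ℝ) {lam : ℝ}
    (hlam : 1 ≤ lam) (x : Fin n → ℝ) :
    lam⁻¹ * (x ⬝ᵥ ((matG k p 1).mulVec x)) ≤ x ⬝ᵥ ((matG k p lam).mulVec x) := by
  have h0 : 0 < lam := by linarith
  refine hasSum_le (fun l => ?_) ((hasSum_dotProduct_matG hk one_pos p x).mul_left lam⁻¹)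
    (hasSum_dotProduct_matG hk h0 p x)
  have hN := powNorm_nonneg k l
  rw [← mul_assoc]
  refine mul_le_mul_of_nonneg_right ?_ (fourierSq_nonneg p x l)
  rw [one_div, one_div, ← mul_inv]
  exact inv_anti₀ (by positivity) (by nlinarith)

/-- The zero frequency alone contributes `n ^ 2`. -/
theorem sq_le_dotProduct_matG_ones {m n k : ℕ} (hk : m < 2 * k) (p : Fin n → Fin m → ℝ) {lam : ℝ}
    (hlam : 0 < lam) :
    (n : ℝ) ^ 2 ≤ (fun _ => 1) ⬝ᵥ ((matG k p lam).mulVec fun _ => 1) := by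
  have h := le_hasSum (hasSum_dotProduct_matG hk hlam p fun _ => 1) 0 fun l _ =>
    mul_nonneg (by have := powNorm_nonneg k l; positivity) (fourierSq_nonneg p _ l)
  have hk0 : k ≠ 0 := by omega
  simpa [fourierSq, phase_zero_left, powNorm_zero hk0] using h

/-! ### The kernel as an analytic function of `1 / lam` -/

/-- The kernel as a function of `t = 1 / lam`, extended through `t = 0`. -/
noncomputable def kernelInv {m : ℕ} (k : ℕ) (x : Fin m → ℝ) (t : ℝ) : ℝ :=
  -- Zero frequency is separated because `t / t` evaluates to `0` at `t = 0`.
  ∑' l : Fin m → ℤ, (if l = 0 then 1 else t / (t + powNorm k l)) * Real.cos (phase l x)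

theorem kernelInv_zero {m : ℕ} (k : ℕ) (x : Fin m → ℝ) : kernelInv k x 0 = 1 := by
  rw [kernelInv, tsum_eq_single 0]
  · simp [phase_zero_left]
  · intro l hl
    simp [hl]

theorem kernelInv_neg {m : ℕ} (k : ℕ) (x : Fin m → ℝ) (t : ℝ) :
    kernelInv k (-x) t = kernelInv k x t := by
  simp [kernelInv, phase]

theorem kernelG_eq_kernelInv {m k : ℕ} (hk : k ≠ 0) {lam : ℝ} (hlam : 0 < lam) (x : Fin m → ℝ) :
    kernelG k lam x = kernelInv k x lam⁻¹ := by
  refine tsum_congr fun l => ?_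
  congr 1
  split_ifs with h
  · simp [h, powNorm_zero hk]
  · have hN := powNorm_nonneg k l
    have : lam⁻¹ + powNorm k l = lam⁻¹ * (1 + lam * powNorm k l) := by
      field_simp
    rw [this, div_mul_eq_div_div, div_self (inv_ne_zero hlam.ne')]

/-- For complex `t` the poles `-powNorm k l`, `l ≠ 0`, lie at distance at least `1` from `0`, so on
the disc of radius `1 / 2` the series is a dominated sum of holomorphic functions. -/
theorem analyticAt_kernelInv {m k : ℕ} (hk : m < 2 * k) (x : Fin m → ℝ) :
    AnalyticAt ℝ (kernelInv k x) 0 := by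
  let F : (Fin m → ℤ) → ℂ → ℂ := fun l z =>
    (if l = 0 then 1 else z / (z + (powNorm k l : ℂ))) * (Real.cos (phase l x) : ℂ)
  have hden : ∀ l : Fin m → ℤ, l ≠ 0 → ∀ z ∈ Metric.ball (0 : ℂ) (1 / 2),
      powNorm k l / 2 ≤ ‖z + (powNorm k l : ℂ)‖ := by
    intro l hl z hz
    have hN := one_le_powNorm (k := k) hl
    have h1 : ‖(powNorm k l : ℂ)‖ - ‖-z‖ ≤ ‖(powNorm k l : ℂ) - -z‖ := norm_sub_norm_le _ _
    rw [Complex.norm_real, Real.norm_of_nonneg (powNorm_nonneg k l), norm_neg, sub_neg_eq_add,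
      add_comm] at h1
    rw [mem_ball_zero_iff] at hz
    linarith
  have hdiff : DifferentiableOn ℂ (fun z => ∑' l, F l z) (Metric.ball 0 (1 / 2)) := by
    refine Complex.differentiableOn_tsum_of_summable_norm (summable_single_add_inv_powNorm hk)
      (fun l => ?_) Metric.isOpen_ball fun l z hz => ?_
    · refine DifferentiableOn.mul_const ?_ _
      by_cases hl : l = 0
      · simp [hl]
      · simp only [hl, if_false]
        refine differentiableOn_id.div (differentiableOn_id.add_const _) fun z hz h0 => ?_
        have h1 := hden l hl z hz
        have hN := one_le_powNorm (k := k) hl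
        rw [h0, norm_zero] at h1
        linarith
    · have hcos : ‖(Real.cos (phase l x) : ℂ)‖ ≤ 1 := by
        rw [Complex.norm_real]; exact Real.abs_cos_le_one _
      refine (norm_mul_le _ _).trans ((mul_le_of_le_one_right (norm_nonneg _) hcos).trans ?_)
      by_cases hl : l = 0
      · simpa [hl] using powNorm_nonneg k (0 : Fin m → ℤ)
      · have hN := one_le_powNorm (k := k) hl
        simp only [hl, if_false, zero_add]
        have h1 := hden l hl z hz
        rw [mem_ball_zero_iff] at hz
        rw [norm_div, div_le_iff₀ (by linarith)]
        calc ‖z‖ ≤ 1 / 2 := hz.le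
          _ = (powNorm k l)⁻¹ * (powNorm k l / 2) := by field_simp
          _ ≤ _ := by gcongr
  have hF : AnalyticAt ℂ (fun z => ∑' l, F l z) ((0 : ℝ) : ℂ) :=
    hdiff.analyticAt (by simpa using Metric.ball_mem_nhds (0 : ℂ) (by norm_num : (0 : ℝ) < 1 / 2))
  have heq : kernelInv k x = fun t : ℝ => (∑' l, F l (t : ℂ)).re := by
    ext t
    have : ((kernelInv k x t : ℝ) : ℂ) = ∑' l, F l (t : ℂ) := by
      rw [kernelInv, Complex.ofReal_tsum]
      refine tsum_congr fun l => ?_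
      simp only [F]
      split_ifs <;> push_cast <;> rfl
    rw [← this, Complex.ofReal_re]
  rw [heq]
  exact hF.re_ofReal

/-! ### Expansions at infinity -/

theorem HasExpansionAtInfinity.exists_abs_sub_le {f : ℝ → ℝ} {a : ℕ → ℝ}
    (h : HasExpansionAtInfinity f a) :
    ∃ K : ℝ, ∀ᶠ lam : ℝ in atTop, |f lam - a 0 - a 1 / lam| ≤ K / lam ^ 2 := by
  obtain ⟨lam₀, h₀, hpos₀⟩ := (h.and (eventually_gt_atTop 0)).exists
  have hsum : Summable fun r => |a (r + 2)| / lam₀ ^ r := by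
    have h1 := ((summable_nat_add_iff 2).2 h₀.summable).abs.mul_left (lam₀ ^ 2)
    refine h1.congr fun r => ?_
    rw [abs_div, abs_of_pos (pow_pos hpos₀ _), pow_add]
    field_simp
  refine ⟨∑' r, |a (r + 2)| / lam₀ ^ r, ?_⟩
  filter_upwards [h, eventually_ge_atTop lam₀] with lam h1 hle
  have hpos : 0 < lam := hpos₀.trans_le hle
  have h2 : HasSum (fun r => a (r + 2) / lam ^ (r + 2)) (f lam - a 0 - a 1 / lam) := by
    have := (hasSum_nat_add_iff' 2).2 h1
    simpa [Finset.sum_range_succ, sub_sub] using this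
  have h3 := (hsum.hasSum.div_const (lam ^ 2))
  rw [← h2.tsum_eq, ← h3.tsum_eq, ← Real.norm_eq_abs]
  refine tsum_of_norm_bounded h3.summable.hasSum fun r => ?_
  rw [Real.norm_eq_abs, abs_div, abs_of_pos (pow_pos hpos _), pow_add, div_mul_eq_div_div]
  gcongr

theorem HasExpansionAtInfinity.tendsto_mul_sub {f : ℝ → ℝ} {a : ℕ → ℝ}
    (h : HasExpansionAtInfinity f a) :
    Tendsto (fun lam => lam * (f lam - a 0)) atTop (𝓝 (a 1)) := by
  obtain ⟨K, hK⟩ := h.exists_abs_sub_le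
  rw [← tendsto_sub_nhds_zero_iff]
  refine squeeze_zero_norm' (a := fun lam => K / lam) ?_ (tendsto_const_nhds.div_atTop tendsto_id)
  filter_upwards [hK, eventually_gt_atTop 0] with lam h1 h2
  have e : lam * (f lam - a 0) - a 1 = lam * (f lam - a 0 - a 1 / lam) := by
    field_simp
  rw [e, norm_mul, Real.norm_of_nonneg h2.le, Real.norm_eq_abs]
  calc _ ≤ lam * (K / lam ^ 2) := by gcongr
    _ = _ := by field_simp

theorem HasExpansionAtInfinity.tendsto {f : ℝ → ℝ} {a : ℕ → ℝ}
    (h : HasExpansionAtInfinity f a) : Tendsto f atTop (𝓝 (a 0)) := by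
  rw [← tendsto_sub_nhds_zero_iff]
  have h1 := h.tendsto_mul_sub.mul tendsto_inv_atTop_zero
  rw [mul_zero] at h1
  refine h1.congr' ?_
  filter_upwards [eventually_gt_atTop 0] with lam hlam
  field_simp

theorem AnalyticAt.exists_hasExpansionAtInfinity {f g : ℝ → ℝ} (hg : AnalyticAt ℝ g 0)
    (h : ∀ᶠ t in 𝓝[>] 0, f t⁻¹ = g t) : ∃ a, HasExpansionAtInfinity f a := by
  obtain ⟨q, hq⟩ := hg
  refine ⟨q.coeff, ?_⟩
  have h1 : ∀ᶠ t in 𝓝[>] (0 : ℝ), HasSum (fun r => q.coeff r / t⁻¹ ^ r) (f t⁻¹) := by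
    filter_upwards [h, nhdsWithin_le_nhds hq.eventually_hasSum] with t h1 h2
    rw [h1]
    simpa [div_eq_mul_inv, mul_comm] using h2
  filter_upwards [tendsto_inv_atTop_nhdsGT_zero.eventually h1] with lam hlam
  simpa using hlam

/-! ### Eigenvalues of `G_lam` and the conclusion -/

theorem rho_exists_expansion {m n k : ℕ} (hk : m < 2 * k) (p : Fin n → Fin m → ℝ) (l : Fin n) :
    ∃ a : ℕ → ℝ, HasExpansionAtInfinity (rho k p l) a := by
  let H : ℝ → Matrix (Fin n) (Fin n) ℝ := fun t => Matrix.of fun i j => kernelInv k (p i - p j) t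
  have hherm : ∀ t, (H t).IsHermitian := by
    intro t
    ext i j
    simp only [Matrix.conjTranspose_apply, H, Matrix.of_apply, star_trivial]
    rw [← kernelInv_neg, neg_sub]
  obtain ⟨f, hf, hev⟩ := exists_analytic_eigenvalues (H := H)
    (fun i j => analyticAt_kernelInv hk (p i - p j)) hherm
  refine (hf l).exists_hasExpansionAtInfinity ?_
  filter_upwards [hev, self_mem_nhdsWithin] with t h1 h2
  rw [← h1 l]
  have e : matG k p t⁻¹ = H t := by
    ext i j
    simp only [matG, H, Matrix.of_apply]
    rw [kernelG_eq_kernelInv (by omega) (inv_pos.2 h2), inv_inv]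
  simp only [rho, e]

theorem rho_eq_eigenvalues {m n : ℕ} (k : ℕ) (p : Fin n → Fin m → ℝ) (lam : ℝ) (l : Fin n) :
    ∃ i, rho k p l lam = (matG_isHermitian k p lam).eigenvalues i :=
  ⟨Fintype.equivOfCardEq (Fintype.card_fin _) (Fin.cast (Fintype.card_fin n).symm l), by
    simp [rho, Matrix.IsHermitian.eigenvalues]⟩

theorem eigenvalues_le_rho_zero {m n : ℕ} (k : ℕ) (p : Fin n → Fin m → ℝ) (lam : ℝ)
    {l : Fin n} (hl : (l : ℕ) = 0) (i : Fin n) :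
    (matG_isHermitian k p lam).eigenvalues i ≤ rho k p l lam :=
  (matG_isHermitian k p lam).eigenvalues₀_antitone (by rw [Fin.le_def]; simp [hl])

/-- This is the trace: every diagonal entry is the kernel at `0`. -/
theorem sum_rho {m n k : ℕ} (hk : k ≠ 0) (p : Fin n → Fin m → ℝ) {lam : ℝ} (hlam : 0 < lam) :
    ∑ l, rho k p l lam = n * kernelInv k (0 : Fin m → ℝ) lam⁻¹ := by
  have h1 : ∑ l, rho k p l lam = ∑ i, (matG_isHermitian k p lam).eigenvalues i := by
    let e : Fin n ≃ Fin n := (finCongr (Fintype.card_fin n).symm).trans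
      (Fintype.equivOfCardEq (Fintype.card_fin _))
    rw [← Equiv.sum_comp e (matG_isHermitian k p lam).eigenvalues]
    refine Finset.sum_congr rfl fun l _ => ?_
    simp [rho, Matrix.IsHermitian.eigenvalues, e]
  have h2 := (matG_isHermitian k p lam).trace_eq_sum_eigenvalues
  simp only [RCLike.ofReal_real_eq_id, id_eq] at h2
  rw [h1, ← h2, Matrix.trace]
  simp [matG, kernelG_eq_kernelInv hk hlam]

theorem rho_nonneg {m n k : ℕ} (hk : m < 2 * k) {p : Fin n → Fin m → ℝ} (hp : DistinctOnTorus p)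
    {lam : ℝ} (hlam : 0 < lam) (l : Fin n) : 0 ≤ rho k p l lam := by
  obtain ⟨i, hi⟩ := rho_eq_eigenvalues k p lam l
  rw [hi]
  exact ((matG_posDef hk hp hlam).eigenvalues_pos i).le

theorem card_le_rho_zero {m n k : ℕ} (hk : m < 2 * k) (p : Fin n → Fin m → ℝ) {lam : ℝ}
    (hlam : 0 < lam) {l : Fin n} (hl : (l : ℕ) = 0) : (n : ℝ) ≤ rho k p l lam := by
  have hn : (0 : ℝ) < n := by exact_mod_cast Fin.pos l
  have h1 := sq_le_dotProduct_matG_ones hk p hlam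
  have h2 := dotProduct_mulVec_le_of_eigenvalues_le (matG_isHermitian k p lam)
    (eigenvalues_le_rho_zero k p lam hl) fun _ => 1
  have h3 : (fun _ : Fin n => (1 : ℝ)) ⬝ᵥ (fun _ => 1) = n := by simp [dotProduct]
  rw [h3] at h2
  nlinarith

theorem exists_pos_le_mul_rho {m n k : ℕ} (hk : m < 2 * k) {p : Fin n → Fin m → ℝ}
    (hp : DistinctOnTorus p) :
    ∃ c : ℝ, 0 < c ∧ ∀ lam : ℝ, 1 ≤ lam → ∀ l, c ≤ lam * rho k p l lam := by
  obtain ⟨c, hc, h⟩ := (matG_posDef hk hp one_pos).exists_pos_mul_le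
  refine ⟨c, hc, fun lam hlam l => ?_⟩
  have h0 : 0 < lam := by linarith
  obtain ⟨i, hi⟩ := rho_eq_eigenvalues k p lam l
  rw [hi, ← inv_mul_le_iff₀ h0]
  refine le_eigenvalues_of_forall_le _ (fun x => ?_) i
  rw [mul_assoc]
  exact (mul_le_mul_of_nonneg_left (h x) (inv_nonneg.2 h0.le)).trans
    (dotProduct_matG_one_le hk p hlam x)

theorem tendsto_rho {m n k : ℕ} (hk : m < 2 * k) {p : Fin n → Fin m → ℝ}
    (hp : DistinctOnTorus p) (l : Fin n) :
    Tendsto (rho k p l) atTop (𝓝 (if (l : ℕ) = 0 then (n : ℝ) else 0)) := by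
  have hk0 : k ≠ 0 := by omega
  have htrace : Tendsto (fun lam : ℝ => n * kernelInv k (0 : Fin m → ℝ) lam⁻¹) atTop
      (𝓝 (n : ℝ)) := by
    have h1 := (analyticAt_kernelInv hk (0 : Fin m → ℝ)).continuousAt.tendsto.comp
      tendsto_inv_atTop_zero
    rw [kernelInv_zero] at h1
    simpa using h1.const_mul (n : ℝ)
  split_ifs with hl
  · refine tendsto_of_tendsto_of_tendsto_of_le_of_le' tendsto_const_nhds htrace ?_ ?_
    · filter_upwards [eventually_gt_atTop 0] with lam hlam
      exact card_le_rho_zero hk p hlam hl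
    · filter_upwards [eventually_gt_atTop 0] with lam hlam
      rw [← sum_rho hk0 p hlam]
      exact Finset.single_le_sum (f := fun l => rho k p l lam)
        (fun i _ => rho_nonneg hk hp hlam i) (Finset.mem_univ l)
  · have h2 := htrace.sub_const (n : ℝ)
    rw [sub_self] at h2
    refine tendsto_of_tendsto_of_tendsto_of_le_of_le' tendsto_const_nhds h2 ?_ ?_
    · filter_upwards [eventually_gt_atTop 0] with lam hlam
      exact rho_nonneg hk hp hlam l
    · filter_upwards [eventually_gt_atTop 0] with lam hlam
      let z : Fin n := ⟨0, Fin.pos l⟩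
      have hz : z ≠ l := fun h => hl (by rw [← h])
      have h3 := card_le_rho_zero hk p hlam (l := z) rfl
      -- The trace bounds `rho z + rho l`, and `rho z ≥ n`, so `rho l` is at most the trace minus
      -- `n`, which tends to `0`.
      have h4 := Finset.add_le_sum (f := fun l => rho k p l lam) (s := Finset.univ)
        (fun i _ => rho_nonneg hk hp hlam i) (Finset.mem_univ z) (Finset.mem_univ l) hz
      rw [sum_rho hk0 p hlam] at h4
      linarith

theorem mainTheorem5 (m n k : ℕ) (hk : (m : ℝ) / 2 < (k : ℝ))
    (p : Fin n → Fin m → ℝ) (hp : DistinctOnTorus p) :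
    (∀ lam : ℝ, 0 < lam → (matG k p lam).PosDef) ∧
    (∀ l : Fin n, ∃ a : ℕ → ℝ, HasExpansionAtInfinity (rho k p l) a) ∧
    (∀ (l : Fin n) (a : ℕ → ℝ), HasExpansionAtInfinity (rho k p l) a →
      a 0 = (if (l : ℕ) = 0 then (n : ℝ) else 0) ∧ (1 ≤ (l : ℕ) → 0 < a 1)) := by
  have hk' : m < 2 * k := by
    have : (m : ℝ) < 2 * k := by linarith
    exact_mod_cast this
  refine ⟨fun lam hlam => matG_posDef hk' hp hlam, rho_exists_expansion hk' p, fun l a ha => ?_⟩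
  have h0 := tendsto_nhds_unique ha.tendsto (tendsto_rho hk' hp l)
  refine ⟨h0, fun hl => ?_⟩
  rw [if_neg (by omega)] at h0
  obtain ⟨c, hc, h⟩ := exists_pos_le_mul_rho hk' hp
  refine hc.trans_le (ge_of_tendsto ha.tendsto_mul_sub ?_)
  filter_upwards [eventually_ge_atTop 1] with lam hlam
  rw [h0, sub_zero]
  exact h lam hlam l
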